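/- \textbf{Recovery under partial observations.} Let $n_o\ge 1$, $n_h\ge 0$, $N=n_o+n_h$, and let $$A=\begin{bmatrix}B&C\\ C^\top&E\end{bmatrix}\in\mathbb{R}^{N\times N},\qquad B\in\mathbb{R}^{n_o\times n_o},\ C\in\mathbb{R}^{n_o\times n_h},\ E\in\mathbb{R}^{n_h\times n_h},$$ be symmetric with spectral radius $\rho(A)<1$. Let $\xi_0,\xi_1,\dots$ be i.i.d. $\mathcal N(0,\sigma^2 I_N)$ random vectors, let $x_0=0$ and $x_t=Ax_{t-1}+\xi_{t-1}$ for $t\ge1$, and let $x_{t,o}\in\mathbb{R}^{n_o}$ be the vector of the first $n_o$ (observed) coordinates of $x_t$. For $m\ge0$ and $T>m+2$ put $$\hat S_m=\frac1{T-m}\sum_{t=0}^{T-m-1}x_{t,o}x_{t+m,o}^\top-\frac1{T-m-2}\sum_{t=0}^{T-m-3}x_{t,o}x_{t+m+2,o}^\top ,$$ and define $$\hat\sigma^2=\tfrac1{n_o}\mathrm{Tr}(\hat S_0),\qquad \hat B=\tfrac1{\hat\sigma^2}\hat S_1,\qquad \widehat{CC^\top}=\tfrac1{\hat\sigma^2}\hat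 S_2-\hat B^2,$$ $$\widehat{CEC^\top}=\tfrac1{\hat\sigma^2}\hat S_3-\hat B^3-\widehat{CC^\top}\,\hat B-\hat B\,\widehat{CC^\top}.$$ Write $\|M\|_{\max}=\max_{i,j}|M_{ij}|$. Let $\kappa=\max\{64\sigma^4,32^2\}$, $0<\epsilon<\sigma^2/2$ and $\delta>0$. (For $\delta>2N^2$, where the logarithm below is negative, read its square root as $0$; for $\delta\ge1$ the claim is trivial.) Then for every integer $T\ge 0$, with probability at least $1-\delta$, the following hold simultaneously: \begin{itemize} \item if $T\ge\max\left(\frac{\kappa\left(1+2\sqrt{\log(2N^2/\delta)}\right)^2}{\epsilon^2(1-\rho(A))^4},\,6\right)$, then $|\hat\sigma^2-\sigma^2|\le\epsilon$ and $\|\hat B-B\|_{\max}\le\epsilon$; \item if $T\ge\max\left(\frac{20^2\kappa N^2\left(1+2\sqrt{\log(2N^2/\delta)}\right)^2}{\epsilon^2(1-\rho(A))^4},\,8\right)$, then $\|\widehat{CC^\top}-CC^\top\|_{\max}\le\epsilon$; \item if $T\ge\max\left(\frac{140^2\kappa N^4\left(1+2\sqrt{\log(2N^2/\delta)}\right)^2}{\epsilon^2(1-\rho(A))^4},\,10\right)$,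 then $\|\widehat{CEC^\top}-CEC^\top\|_{\max}\le\epsilon$. \end{itemize} -/

import Mathlib

open scoped ENNReal
open MeasureTheory ProbabilityTheory

noncomputable section

namespace PartialObs

/-- The state trajectory of `x_t = A x_{t-1} + ξ_{t-1}` with `x_0 = 0`, driven by the noise
sequence `ξ`. -/
def state {ι : Type*} [Fintype ι] (A : Matrix ι ι ℝ) (ξ : ℕ → EuclideanSpace ℝ ι) :
    ℕ → ι → ℝ
  | 0 => 0
  | t + 1 => A.mulVec (state A ξ t) + WithLp.ofLp (ξ t)

/-- The block system matrix `[[B, C], [Cᵀ, E]]`; the first block of coordinates is observed and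
the second one is hidden. -/
def systemMatrix {no nh : ℕ} (B : Matrix (Fin no) (Fin no) ℝ) (C : Matrix (Fin no) (Fin nh) ℝ)
    (E : Matrix (Fin nh) (Fin nh) ℝ) : Matrix (Fin no ⊕ Fin nh) (Fin no ⊕ Fin nh) ℝ :=
  Matrix.fromBlocks B C C.transpose E

/-- The observed part `x_{t,o}` of a trajectory. -/
def observed {no nh : ℕ} (x : ℕ → Fin no ⊕ Fin nh → ℝ) (t : ℕ) : Fin no → ℝ :=
  fun i => x t (Sum.inl i)

/-- The spectral radius of a real matrix (the largest modulus of its complex eigenvalues), as an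
extended nonnegative real. -/
def rho {ι : Type*} [Fintype ι] [DecidableEq ι] (A : Matrix ι ι ℝ) : ℝ≥0∞ :=
  spectralRadius ℂ (A.map (fun a : ℝ => (a : ℂ)))

/-- The elementwise maximum norm `max_{i,j} |M i j|`. -/
def maxNorm {n : ℕ} (M : Matrix (Fin n) (Fin n) ℝ) : ℝ :=
  ⨆ p : Fin n × Fin n, |M p.1 p.2|

/-- The moment estimator
`1/(T-m) ∑_{t=0}^{T-m-1} y_t y_{t+m}ᵀ - 1/(T-m-2) ∑_{t=0}^{T-m-3} y_t y_{t+m+2}ᵀ`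
of an observed trajectory `y`; it is meant for `T > m + 2`. -/
def momentEst {n : ℕ} (T : ℕ) (y : ℕ → Fin n → ℝ) (m : ℕ) : Matrix (Fin n) (Fin n) ℝ :=
  (1 / ((T : ℝ) - m)) • ∑ t ∈ Finset.range (T - m), Matrix.vecMulVec (y t) (y (t + m)) -
    (1 / ((T : ℝ) - m - 2)) •
      ∑ t ∈ Finset.range (T - m - 2), Matrix.vecMulVec (y t) (y (t + m + 2))

/-- The estimator of the noise variance `σ²`. -/
def varEst {n : ℕ} (T : ℕ) (y : ℕ → Fin n → ℝ) : ℝ :=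
  (1 / (n : ℝ)) * (momentEst T y 0).trace

/-- The estimator of `B`. -/
def BEst {n : ℕ} (T : ℕ) (y : ℕ → Fin n → ℝ) : Matrix (Fin n) (Fin n) ℝ :=
  (1 / varEst T y) • momentEst T y 1

/-- The estimator of `C Cᵀ`. -/
def CCEst {n : ℕ} (T : ℕ) (y : ℕ → Fin n → ℝ) : Matrix (Fin n) (Fin n) ℝ :=
  (1 / varEst T y) • momentEst T y 2 - BEst T y ^ 2

/-- The estimator of `C E Cᵀ`. -/
def CECEst {n : ℕ} (T : ℕ) (y : ℕ → Fin n → ℝ) : Matrix (Fin n) (Fin n) ℝ :=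
  (1 / varEst T y) • momentEst T y 3 - BEst T y ^ 3 - CCEst T y * BEst T y -
    BEst T y * CCEst T y

/-- The constant `κ = max {64 σ⁴, 32²}`. -/
def kappa (σ : ℝ) : ℝ := max (64 * σ ^ 4) (32 ^ 2)

/-- The basic sample size `κ (1 + 2 √(log (2 N² / δ)))² / (ε² (1 - ρ)⁴)`. -/
def sampleSize (σ ε δ r : ℝ) (N : ℕ) : ℝ :=
  kappa σ * (1 + 2 * Real.sqrt (Real.log (2 * (N : ℝ) ^ 2 / δ))) ^ 2 / (ε ^ 2 * (1 - r) ^ 4)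

end PartialObs

end

/-! Write A for the system matrix, r for its spectral radius, c = (1/(1-r))². Each coordinate of x_t
is a linear functional of the noise, so a lag-l sum of products of coordinates is a Gaussian
quadratic form. The map from noise to trajectory has ℓ² gain at most 1/(1-r); hence with n summands
the form has operator norm at most c and trace norm at most n c, and a Chernoff bound gives a
deviation n c θ probability at most 2 exp(-nθ²/12) (`stdGaussian_bilinear_tail`, `autocov_tail`).

The mean of that sum is σ² ∑_t ∑_{k<t} A^(2k+l). Subtracting the normalised lag m+2 from lag m
cancels the series except for A^m, up to a bias of order 1/T caused by the zero initial state
(`abs_autocov_mean_sub_le`). So the moment estimators approximate the observed block of σ² A^m for m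
≤ 3, after a union bound over six lags and all pairs of observed coordinates.

What remains is deterministic: the observed blocks of A² and A³ determine C Cᵀ and C E Cᵀ given B,
and these polynomial expressions are Lipschitz with constants of order N and N²
(`estimators_accurate`). -/

/-! ### Exponential moments of the square of a standard normal. -/

theorem integrable_exp_mul_sq_gaussianReal {a : ℝ} (ha : a < 1 / 2) :
    Integrable (fun x : ℝ => Real.exp (a * x ^ 2)) (gaussianReal 0 1) ∧
      ∫ x, Real.exp (a * x ^ 2) ∂(gaussianReal 0 1) = (Real.sqrt (1 - 2 * a))⁻¹ := by
  have hb : 0 < 1 / 2 - a := by linarith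
  have hfun : ∀ x : ℝ, gaussianPDFReal 0 1 x * Real.exp (a * x ^ 2) =
      (Real.sqrt (2 * Real.pi))⁻¹ * Real.exp (-(1 / 2 - a) * x ^ 2) := by
    intro x
    rw [gaussianPDFReal_def]
    simp only [NNReal.coe_one, mul_one, sub_zero]
    rw [mul_assoc, ← Real.exp_add]
    congr 2
    ring
  constructor
  · rw [gaussianReal_of_var_ne_zero 0 one_ne_zero]
    rw [integrable_withDensity_iff_integrable_smul' (measurable_gaussianPDF 0 1)
      (Filter.Eventually.of_forall fun x => gaussianPDF_lt_top)]
    simp only [toReal_gaussianPDF, smul_eq_mul, hfun]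
    exact (integrable_exp_neg_mul_sq hb).const_mul _
  · rw [integral_gaussianReal_eq_integral_smul one_ne_zero]
    simp only [smul_eq_mul, hfun]
    rw [integral_const_mul, integral_gaussian, ← Real.sqrt_inv, ← Real.sqrt_mul (by positivity),
      ← Real.sqrt_inv]
    congr 1
    have : 1 - 2 * a ≠ 0 := by linarith
    have h2 : 1 / 2 - a ≠ 0 := hb.ne'
    field_simp

/-- Taylor expansion of -½ log(1 - 2a) = a + a² + ...: for |2a| ≤ 1/2 the cubic remainder costs at
most another 2a². The term a is the mean, removed later by centring. -/
theorem integral_exp_mul_sq_le {a : ℝ} (ha : |a| ≤ 1 / 4) :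
    ∫ x, Real.exp (a * x ^ 2) ∂(gaussianReal 0 1) ≤ Real.exp (a + 3 * a ^ 2) := by
  obtain ⟨h1, h2⟩ := abs_le.mp ha
  rw [(integrable_exp_mul_sq_gaussianReal (by linarith)).2]
  have h3 : Real.exp (-(a + 3 * a ^ 2)) ≤ Real.sqrt (1 - 2 * a) := by
    apply Real.le_sqrt_of_sq_le
    rw [← Real.exp_nat_mul]
    have h4 : 0 < 1 - 2 * a := by linarith
    rw [← Real.le_log_iff_exp_le h4]
    have h5 := Real.abs_log_sub_add_sum_range_le (x := 2 * a)
      (by rw [abs_lt]; constructor <;> linarith) 2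
    have h6 : |2 * a| ^ (2 + 1) / (1 - |2 * a|) ≤ |2 * a| ^ 2 := by
      have h7 : |2 * a| ≤ 1 / 2 := by rw [abs_le]; constructor <;> linarith
      rw [div_le_iff₀ (by linarith)]
      generalize |2 * a| = x at h7 ⊢
      rw [pow_succ x 2]
      nlinarith [mul_nonneg (sq_nonneg x) (by linarith : 0 ≤ 1 / 2 - x)]
    have h8 := (abs_le.mp (h5.trans h6)).1
    simp only [Finset.sum_range_succ, Finset.sum_range_zero, sq_abs] at h8
    norm_num at h8 ⊢
    nlinarith
  calc (Real.sqrt (1 - 2 * a))⁻¹ ≤ (Real.exp (-(a + 3 * a ^ 2)))⁻¹ :=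
        inv_anti₀ (Real.exp_pos _) h3
    _ = Real.exp (a + 3 * a ^ 2) := by rw [← Real.exp_neg, neg_neg]

/-! ### Concentration of Gaussian quadratic and bilinear forms. -/

section QuadraticForm

variable {V : Type*} [NormedAddCommGroup V] [InnerProductSpace ℝ V] [FiniteDimensional ℝ V]
  [MeasurableSpace V] [BorelSpace V]

/-- By rotation invariance the coordinates in any orthonormal basis are independent standard
normals, so the exponential moment factorises. -/
theorem integral_exp_quadratic_stdGaussian {κ : Type*} [Fintype κ] (b : OrthonormalBasis κ ℝ V)
    (μ : κ → ℝ) (hμ : ∀ k, |μ k| ≤ 1 / 4) :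
    Integrable (fun x => Real.exp (∑ k, μ k * inner ℝ (b k) x ^ 2)) (stdGaussian V) ∧
      ∫ x, Real.exp (∑ k, μ k * inner ℝ (b k) x ^ 2) ∂(stdGaussian V) ≤
        Real.exp (∑ k, μ k + 3 * ∑ k, μ k ^ 2) := by
  have hm : Measurable (fun x : κ → ℝ => ∑ i, x i • b i) := by fun_prop
  have hfun : ∀ x : κ → ℝ, Real.exp (∑ k, μ k * inner ℝ (b k) (∑ i, x i • b i) ^ 2) =
      ∏ k, Real.exp (μ k * x k ^ 2) := by
    intro x
    rw [Real.exp_sum]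
    refine Finset.prod_congr rfl fun k _ => ?_
    rw [Orthonormal.inner_right_fintype b.orthonormal]
  have hle : ∀ k, μ k < 1 / 2 := fun k => by linarith [(abs_le.mp (hμ k)).2]
  have hcont : Continuous fun x : V => Real.exp (∑ k, μ k * inner ℝ (b k) x ^ 2) := by fun_prop
  rw [stdGaussian_eq_map_pi_orthonormalBasis b]
  constructor
  · rw [integrable_map_measure hcont.aestronglyMeasurable hm.aemeasurable]
    simp only [Function.comp_def, hfun]
    exact Integrable.fintype_prod (f := fun k (x : ℝ) => Real.exp (μ k * x ^ 2))
      fun k => (integrable_exp_mul_sq_gaussianReal (hle k)).1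
  · rw [integral_map hm.aemeasurable hcont.aestronglyMeasurable]
    simp only [hfun]
    rw [integral_fintype_prod_eq_prod (f := fun k (x : ℝ) => Real.exp (μ k * x ^ 2)),
      Finset.mul_sum, ← Finset.sum_add_distrib, Real.exp_sum]
    exact Finset.prod_le_prod (fun k _ => integral_nonneg fun x => (Real.exp_pos _).le)
      fun k _ => integral_exp_mul_sq_le (hμ k)

/-- Upper tail of a Gaussian quadratic form with eigenvalues `μ`. -/
theorem stdGaussian_quadratic_tail {κ : Type*} [Fintype κ] (b : OrthonormalBasis κ ℝ V)
    (μ : κ → ℝ) {c n θ : ℝ} (hc : 0 < c) (hθ0 : 0 ≤ θ) (hθ1 : θ ≤ 1)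
    (hμ : ∀ k, |μ k| ≤ c) (hsum : ∑ k, |μ k| ≤ n * c) :
    (stdGaussian V).real {x | n * c * θ ≤ ∑ k, μ k * inner ℝ (b k) x ^ 2 - ∑ k, μ k} ≤
      Real.exp (-(n * θ ^ 2 / 12)) := by
  -- Minimiser of the Chernoff exponent -s n c θ + 3 s² n c², with value -nθ²/12; θ ≤ 1 keeps |s μ
  -- k| ≤ 1/6.
  set s : ℝ := θ / (6 * c) with hs
  have hs0 : 0 ≤ s := by positivity
  have hsc : s * c = θ / 6 := by rw [hs]; field_simp
  have hsμ : ∀ k, |s * μ k| ≤ 1 / 4 := by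
    intro k
    rw [abs_mul, abs_of_nonneg hs0]
    nlinarith [mul_le_mul_of_nonneg_left (hμ k) hs0]
  obtain ⟨hint, hle⟩ := integral_exp_quadratic_stdGaussian b (fun k => s * μ k) hsμ
  have hfun : ∀ x, Real.exp (s * (∑ k, μ k * inner ℝ (b k) x ^ 2 - ∑ k, μ k)) =
      Real.exp (-(s * ∑ k, μ k)) * Real.exp (∑ k, s * μ k * inner ℝ (b k) x ^ 2) := by
    intro x
    rw [← Real.exp_add]
    simp only [mul_assoc, ← Finset.mul_sum]
    congr 1
    ring
  have h := measure_ge_le_exp_mul_mgf (μ := stdGaussian V)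
    (X := fun x => ∑ k, μ k * inner ℝ (b k) x ^ 2 - ∑ k, μ k) (n * c * θ) hs0
    (by simp only [hfun]; exact hint.const_mul _)
  refine h.trans ?_
  rw [mgf]
  simp only [hfun]
  rw [integral_const_mul]
  -- ∑ μ² ≤ sup|μ| · ∑|μ| makes the rate depend on n rather than on the dimension of the space.
  have hsq : ∑ k, (s * μ k) ^ 2 ≤ s ^ 2 * (n * c * c) := by
    simp only [mul_pow, ← Finset.mul_sum]
    refine mul_le_mul_of_nonneg_left ?_ (sq_nonneg s)
    calc ∑ k, μ k ^ 2 ≤ ∑ k, |μ k| * c := Finset.sum_le_sum fun k _ => by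
          rw [← sq_abs, sq]; exact mul_le_mul_of_nonneg_left (hμ k) (abs_nonneg _)
      _ ≤ n * c * c := by rw [← Finset.sum_mul]; exact mul_le_mul_of_nonneg_right hsum hc.le
  calc _ ≤ Real.exp (-s * (n * c * θ)) * (Real.exp (-(s * ∑ k, μ k)) *
        Real.exp (∑ k, s * μ k + 3 * ∑ k, (s * μ k) ^ 2)) := by gcongr
    _ ≤ _ := by
      rw [← Real.exp_add, ← Real.exp_add, Real.exp_le_exp, ← Finset.mul_sum]
      have e1 : s ^ 2 * (n * c * c) = n * (θ / 6) ^ 2 := by rw [← hsc]; ring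
      have e2 : s * (n * c * θ) = n * (θ / 6) * θ := by rw [← hsc]; ring
      nlinarith

/-- Upper tail of a Gaussian bilinear form `∑ t, ⟪g t, x⟫ ⟪h t, x⟫`. -/
theorem stdGaussian_bilinear_upper_tail {τ : Type*} (I : Finset τ) (g h : τ → V)
    {c θ : ℝ} (hc : 0 < c) (hθ0 : 0 ≤ θ) (hθ1 : θ ≤ 1)
    (hop : ∀ x, |∑ t ∈ I, inner ℝ (g t) x * inner ℝ (h t) x| ≤ c * ‖x‖ ^ 2)
    (hgh : ∀ t ∈ I, ‖g t‖ * ‖h t‖ ≤ c) :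
    (stdGaussian V).real {x | I.card * c * θ ≤
        ∑ t ∈ I, inner ℝ (g t) x * inner ℝ (h t) x - ∑ t ∈ I, inner ℝ (g t) (h t)} ≤
      Real.exp (-(I.card * θ ^ 2 / 12)) := by
  -- The symmetrised operator has the same quadratic form and can be diagonalised.
  set S : V →ₗ[ℝ] V := ∑ t ∈ I, (1 / 2 : ℝ) •
    ((innerₗ V (g t)).smulRight (h t) + (innerₗ V (h t)).smulRight (g t)) with hS
  have hSapp : ∀ x y, inner ℝ (S x) y = ∑ t ∈ I, (1 / 2 : ℝ) *
      (inner ℝ (g t) x * inner ℝ (h t) y + inner ℝ (h t) x * inner ℝ (g t) y) := by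
    intro x y
    rw [hS]
    simp only [LinearMap.sum_apply, sum_inner, LinearMap.smul_apply, LinearMap.add_apply,
      LinearMap.smulRight_apply, innerₗ_apply_apply, inner_smul_left, inner_add_left]
    simp
  have hsymm : S.IsSymmetric := by
    intro x y
    rw [hSapp, real_inner_comm, hSapp]
    exact Finset.sum_congr rfl fun t _ => by ring
  have hq : ∀ x, inner ℝ (S x) x = ∑ t ∈ I, inner ℝ (g t) x * inner ℝ (h t) x := by
    intro x
    rw [hSapp]
    exact Finset.sum_congr rfl fun t _ => by ring
  set b := hsymm.eigenvectorBasis (rfl : Module.finrank ℝ V = _) with hb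
  set μ := hsymm.eigenvalues (rfl : Module.finrank ℝ V = _) with hμd
  have hbμ : ∀ k, S (b k) = μ k • b k := fun k => hsymm.apply_eigenvectorBasis rfl k
  have hbn : ∀ k, ‖b k‖ = 1 := fun k => b.orthonormal.1 k
  have hμq : ∀ k, μ k = ∑ t ∈ I, inner ℝ (g t) (b k) * inner ℝ (h t) (b k) := by
    intro k
    rw [← hq, hbμ, inner_smul_left, real_inner_self_eq_norm_sq, hbn]
    simp
  have hdiag : ∀ x, ∑ t ∈ I, inner ℝ (g t) x * inner ℝ (h t) x =
      ∑ k, μ k * inner ℝ (b k) x ^ 2 := by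
    intro x
    rw [← hq, ← b.sum_inner_mul_inner (S x) x]
    refine Finset.sum_congr rfl fun k _ => ?_
    rw [hsymm x (b k), hbμ, inner_smul_right, real_inner_comm]
    ring
  have htr : ∑ k, μ k = ∑ t ∈ I, inner ℝ (g t) (h t) := by
    simp only [hμq]
    rw [Finset.sum_comm]
    refine Finset.sum_congr rfl fun t _ => ?_
    rw [← b.sum_inner_mul_inner (g t) (h t)]
    exact Finset.sum_congr rfl fun k _ => by rw [real_inner_comm (b k) (h t)]
  have hμc : ∀ k, |μ k| ≤ c := by
    intro k
    have := hop (b k)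
    rwa [← hμq, hbn, one_pow, mul_one] at this
  -- Trace norm bound: by Cauchy–Schwarz in the eigenbasis, each rank-one term contributes at most
  -- ‖g t‖ ‖h t‖.
  have hμs : ∑ k, |μ k| ≤ I.card * c := by
    calc ∑ k, |μ k| ≤ ∑ k, ∑ t ∈ I, |inner ℝ (g t) (b k)| * |inner ℝ (h t) (b k)| := by
          refine Finset.sum_le_sum fun k _ => ?_
          rw [hμq]
          simp only [← abs_mul]
          exact Finset.abs_sum_le_sum_abs _ _
      _ = ∑ t ∈ I, ∑ k, |inner ℝ (g t) (b k)| * |inner ℝ (h t) (b k)| := Finset.sum_comm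
      _ ≤ ∑ t ∈ I, c := by
          refine Finset.sum_le_sum fun t ht => (?_ : _ ≤ ‖g t‖ * ‖h t‖).trans (hgh t ht)
          refine abs_le_of_sq_le_sq' ?_ (by positivity) |>.2
          refine (Finset.sum_mul_sq_le_sq_mul_sq _ _ _).trans_eq ?_
          simp only [sq_abs]
          rw [b.sum_sq_inner_left, b.sum_sq_inner_left, mul_pow]
      _ = I.card * c := by simp
  simp only [hdiag, ← htr]
  exact stdGaussian_quadratic_tail b μ hc hθ0 hθ1 hμc hμs

/-- Two-sided tail of a Gaussian bilinear form `∑ t, ⟪g t, x⟫ ⟪h t, x⟫`. -/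
theorem stdGaussian_bilinear_tail {τ : Type*} (I : Finset τ) (g h : τ → V)
    {c θ : ℝ} (hc : 0 < c) (hθ0 : 0 ≤ θ) (hθ1 : θ ≤ 1)
    (hop : ∀ x, |∑ t ∈ I, inner ℝ (g t) x * inner ℝ (h t) x| ≤ c * ‖x‖ ^ 2)
    (hgh : ∀ t ∈ I, ‖g t‖ * ‖h t‖ ≤ c) :
    (stdGaussian V).real {x | I.card * c * θ ≤
        |∑ t ∈ I, inner ℝ (g t) x * inner ℝ (h t) x - ∑ t ∈ I, inner ℝ (g t) (h t)|} ≤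
      2 * Real.exp (-(I.card * θ ^ 2 / 12)) := by
  have h1 := stdGaussian_bilinear_upper_tail I g h hc hθ0 hθ1 hop hgh
  have h2 := stdGaussian_bilinear_upper_tail I (fun t => -g t) h hc hθ0 hθ1
    (by simpa [inner_neg_left] using hop) (by simpa using hgh)
  simp only [inner_neg_left, neg_mul, Finset.sum_neg_distrib] at h2
  rw [two_mul]
  refine le_trans (measureReal_mono ?_ (measure_ne_top _ _)) ((measureReal_union_le _ _).trans
    (add_le_add h1 h2))
  intro x hx
  rcases le_abs.mp (show (_ : ℝ) ≤ |_| from hx) with hx | hx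
  · exact Or.inl hx
  · refine Or.inr ?_
    change (_ : ℝ) ≤ _
    linarith

end QuadraticForm

/-! ### The trajectory as a linear function of the noise, and its ℓ² gain. -/

namespace PartialObs

/-- Energy estimate: convexity with weights r and 1-r gives (r a + b)² ≤ r a² + b²/(1-r), and
summing over time absorbs the first term. The boundary term a n² is kept in `key` to make the
induction close. -/
theorem sum_sq_le_of_contraction {a b : ℕ → ℝ} {r : ℝ} (ha : ∀ t, 0 ≤ a t)
    (hr0 : 0 ≤ r) (hr1 : r < 1) (h0 : a 0 = 0) (hstep : ∀ t, a (t + 1) ≤ r * a t + b t) (n : ℕ) :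
    ∑ t ∈ Finset.range n, a t ^ 2 ≤ (1 / (1 - r)) ^ 2 * ∑ s ∈ Finset.range n, b s ^ 2 := by
  have hr : 0 < 1 - r := by linarith
  have key : ∀ n, (1 - r) * ∑ t ∈ Finset.range n, a t ^ 2 + a n ^ 2 ≤
      1 / (1 - r) * ∑ s ∈ Finset.range n, b s ^ 2 := by
    intro n
    induction n with
    | zero => simp [h0]
    | succ n ih =>
      rw [Finset.sum_range_succ, Finset.sum_range_succ, mul_add, mul_add]
      have h1 : a (n + 1) ^ 2 ≤ (r * a n + b n) ^ 2 := pow_le_pow_left₀ (ha _) (hstep n) 2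
      have h2 : (r * a n + b n) ^ 2 ≤ r * a n ^ 2 + 1 / (1 - r) * b n ^ 2 := by
        have h3 : r * a n ^ 2 + 1 / (1 - r) * b n ^ 2 - (r * a n + b n) ^ 2 =
            r * (1 / (1 - r)) * ((1 - r) * a n - b n) ^ 2 := by
          field_simp
          ring
        have h4 : 0 ≤ r * (1 / (1 - r)) * ((1 - r) * a n - b n) ^ 2 := by positivity
        linarith
      linarith
  have h := key n
  have h5 : (1 - r) * ∑ t ∈ Finset.range n, a t ^ 2 ≤
      1 / (1 - r) * ∑ s ∈ Finset.range n, b s ^ 2 := by nlinarith [sq_nonneg (a n)]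
  rw [sq, mul_assoc, div_mul_eq_mul_div, one_mul, le_div_iff₀ hr]
  linarith

variable {ι : Type*} [Fintype ι]

/-- The space of noise sequences of length `T`. -/
abbrev NoiseSpace (T : ℕ) (ι : Type*) [Fintype ι] := PiLp 2 (fun _ : Fin T => EuclideanSpace ℝ ι)

/-- Extension of a finite noise sequence by zero. -/
def extend {T : ℕ} (x : NoiseSpace T ι) (s : ℕ) : EuclideanSpace ℝ ι :=
  if h : s < T then x ⟨s, h⟩ else 0

theorem state_congr (A : Matrix ι ι ℝ) {ξ η : ℕ → EuclideanSpace ℝ ι} {T : ℕ}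
    (h : ∀ s < T, ξ s = η s) : ∀ t ≤ T, state A ξ t = state A η t := by
  intro t
  induction t with
  | zero => intro _; rfl
  | succ t ih =>
    intro ht
    rw [state, state, ih (by lia), h t (by lia)]

theorem sum_norm_extend_sq {T : ℕ} (x : NoiseSpace T ι) :
    ∑ s ∈ Finset.range T, ‖extend x s‖ ^ 2 = ‖x‖ ^ 2 := by
  rw [PiLp.norm_sq_eq_of_L2, ← Fin.sum_univ_eq_sum_range (fun s => ‖extend x s‖ ^ 2)]
  exact Finset.sum_congr rfl fun s _ => by simp [extend]

/-- A matrix that contracts the Euclidean norm by a factor `r`. -/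
def Contracts (A : Matrix ι ι ℝ) (r : ℝ) : Prop :=
  ∀ v : ι → ℝ, ‖WithLp.toLp 2 (A.mulVec v)‖ ≤ r * ‖WithLp.toLp 2 v‖

theorem sum_norm_state_sq_le {A : Matrix ι ι ℝ} {r : ℝ} (hr0 : 0 ≤ r) (hr1 : r < 1)
    (hA : Contracts A r) {T : ℕ} (x : NoiseSpace T ι) :
    ∑ t ∈ Finset.range T, ‖WithLp.toLp 2 (state A (extend x) t)‖ ^ 2 ≤
      (1 / (1 - r)) ^ 2 * ‖x‖ ^ 2 := by
  rw [← sum_norm_extend_sq]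
  refine sum_sq_le_of_contraction (fun t => norm_nonneg _) hr0 hr1 (by simp [state])
    (fun t => ?_) T
  rw [state, WithLp.toLp_add, WithLp.toLp_ofLp]
  exact (norm_add_le _ _).trans (add_le_add_left (hA _) _)

theorem sum_state_apply_sq_le {A : Matrix ι ι ℝ} {r : ℝ} (hr0 : 0 ≤ r) (hr1 : r < 1)
    (hA : Contracts A r) {T : ℕ} (x : NoiseSpace T ι) (i : ι) :
    ∑ t ∈ Finset.range T, state A (extend x) t i ^ 2 ≤ (1 / (1 - r)) ^ 2 * ‖x‖ ^ 2 := by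
  refine (Finset.sum_le_sum fun t _ => ?_).trans (sum_norm_state_sq_le hr0 hr1 hA x)
  rw [← sq_abs]
  exact pow_le_pow_left₀ (abs_nonneg _)
    (PiLp.norm_apply_le (WithLp.toLp 2 (state A (extend x) t)) i) 2

variable [DecidableEq ι]

theorem state_eq_sum (A : Matrix ι ι ℝ) (ξ : ℕ → EuclideanSpace ℝ ι) (t : ℕ) :
    state A ξ t = ∑ s ∈ Finset.range t, (A ^ (t - 1 - s)).mulVec (WithLp.ofLp (ξ s)) := by
  induction t with
  | zero => rfl
  | succ t ih =>
    rw [state, ih, Finset.sum_range_succ, Matrix.mulVec_sum]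
    congr 1
    · refine Finset.sum_congr rfl fun s hs => ?_
      have := Finset.mem_range.mp hs
      rw [Matrix.mulVec_mulVec, ← pow_succ']
      congr 2
      lia
    · simp

/-- The vector representing the linear functional `x ↦ x_t i` on noise sequences. -/
def impulse (A : Matrix ι ι ℝ) (T t : ℕ) (i : ι) : NoiseSpace T ι :=
  WithLp.toLp 2 fun s => WithLp.toLp 2 fun k => if (s : ℕ) < t then (A ^ (t - 1 - s)) i k else 0

theorem inner_impulse (A : Matrix ι ι ℝ) {T t : ℕ} (ht : t ≤ T) (i : ι) (x : NoiseSpace T ι) :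
    inner ℝ (impulse A T t i) x = state A (extend x) t i := by
  rw [state_eq_sum, Finset.sum_apply, PiLp.inner_apply]
  have h1 : ∀ s : Fin T, inner ℝ (impulse A T t i s) (x s) =
      (fun s : ℕ => if s < t then (A ^ (t - 1 - s)).mulVec (WithLp.ofLp (extend x s)) i else 0) s := by
    intro s
    simp only [impulse, extend, PiLp.inner_apply, Fin.is_lt, dif_pos, Matrix.mulVec, dotProduct]
    split_ifs with h
    · refine Finset.sum_congr rfl fun k _ => ?_
      simp [mul_comm]
    · simp
  refine (Finset.sum_congr rfl fun s _ => h1 s).trans ((Fin.sum_univ_eq_sum_range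
    (fun s : ℕ => if s < t then (A ^ (t - 1 - s)).mulVec (WithLp.ofLp (extend x s)) i else 0)
    T).trans ?_)
  rw [← Finset.sum_filter]
  refine Finset.sum_congr ?_ fun _ _ => rfl
  ext s
  simp only [Finset.mem_filter, Finset.mem_range]
  lia

/-- This is the covariance of the two coordinates under standard noise. Symmetry of A merges the two
powers met at time s into one, and k = t-1-s reverses the sum. -/
theorem inner_impulse_impulse {A : Matrix ι ι ℝ} (hA : A.IsSymm) {T t l : ℕ} (ht : t + l ≤ T)
    (i j : ι) :
    inner ℝ (impulse A T t i) (impulse A T (t + l) j) =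
      ∑ k ∈ Finset.range t, (A ^ (2 * k + l)) i j := by
  rw [inner_impulse A (by lia), state_eq_sum, Finset.sum_apply,
    ← Finset.sum_range_reflect (fun k => (A ^ (2 * k + l)) i j)]
  refine Finset.sum_congr rfl fun s hs => ?_
  have hs' := Finset.mem_range.mp hs
  have h1 : 2 * (t - 1 - s) + l = (t - 1 - s) + (t + l - 1 - s) := by lia
  rw [h1, pow_add, Matrix.mul_apply, Matrix.mulVec, dotProduct]
  refine Finset.sum_congr rfl fun k _ => ?_
  have h2 : s < T := by lia
  have h3 : s < t + l := by lia
  simp only [extend, impulse, h2, h3, dif_pos, if_pos]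
  rw [← (hA.pow (t + l - 1 - s)).apply j k]

/-- Driving the system by its own impulse vector g produces ‖g‖² as coordinate i at time t; the ℓ²
gain then gives ‖g‖⁴ ≤ c ‖g‖². -/
theorem norm_impulse_sq_le {A : Matrix ι ι ℝ} {r : ℝ} (hr0 : 0 ≤ r) (hr1 : r < 1)
    (hA : Contracts A r) {T t : ℕ} (ht : t < T) (i : ι) :
    ‖impulse A T t i‖ ^ 2 ≤ (1 / (1 - r)) ^ 2 := by
  have h1 : state A (extend (impulse A T t i)) t i ^ 2 ≤ (1 / (1 - r)) ^ 2 * ‖impulse A T t i‖ ^ 2 :=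
    (Finset.single_le_sum (f := fun t => state A (extend (impulse A T _ i)) t i ^ 2)
      (fun _ _ => sq_nonneg _) (Finset.mem_range.mpr ht)).trans
      (sum_state_apply_sq_le hr0 hr1 hA _ i)
  rw [← inner_impulse A ht.le, real_inner_self_eq_norm_sq] at h1
  rcases (sq_nonneg ‖impulse A T t i‖).eq_or_lt with h | h
  · rw [← h]; positivity
  · rw [sq (‖impulse A T t i‖ ^ 2)] at h1
    exact le_of_mul_le_mul_right h1 h

/-- Concentration of the lag-`l` autocovariances of the state driven by standard noise. -/
theorem stdGaussian_autocov_tail {A : Matrix ι ι ℝ} (hAs : A.IsSymm) {r : ℝ} (hr0 : 0 ≤ r)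
    (hr1 : r < 1) (hA : Contracts A r) {θ : ℝ} (hθ0 : 0 ≤ θ) (hθ1 : θ ≤ 1) {T n l : ℕ}
    (hn : n + l = T) (i j : ι) :
    (stdGaussian (NoiseSpace T ι)).real {x | n * (1 / (1 - r)) ^ 2 * θ ≤
      |∑ t ∈ Finset.range n, state A (extend x) t i * state A (extend x) (t + l) j -
        ∑ t ∈ Finset.range n, ∑ k ∈ Finset.range t, (A ^ (2 * k + l)) i j|} ≤
      2 * Real.exp (-(n * θ ^ 2 / 12)) := by
  have hr : 0 < 1 - r := by linarith
  have hst : ∀ x : NoiseSpace T ι,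
      ∑ t ∈ Finset.range n, inner ℝ (impulse A T t i) x * inner ℝ (impulse A T (t + l) j) x =
      ∑ t ∈ Finset.range n, state A (extend x) t i * state A (extend x) (t + l) j := by
    intro x
    refine Finset.sum_congr rfl fun t ht => ?_
    have := Finset.mem_range.mp ht
    rw [inner_impulse A (by lia), inner_impulse A (by lia)]
  have h := stdGaussian_bilinear_tail (Finset.range n) (fun t => impulse A T t i)
    (fun t => impulse A T (t + l) j) (c := (1 / (1 - r)) ^ 2) (by positivity) hθ0 hθ1 ?_ ?_
  · have hmean : ∑ t ∈ Finset.range n, inner ℝ (impulse A T t i) (impulse A T (t + l) j) =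
        ∑ t ∈ Finset.range n, ∑ k ∈ Finset.range t, (A ^ (2 * k + l)) i j := by
      refine Finset.sum_congr rfl fun t ht => inner_impulse_impulse hAs ?_ i j
      have := Finset.mem_range.mp ht
      lia
    simp only [hst, hmean, Finset.card_range] at h
    exact h
  · intro x
    rw [hst]
    refine (Finset.abs_sum_le_sum_abs _ _).trans ?_
    have h1 : ∑ t ∈ Finset.range n, state A (extend x) t i ^ 2 ≤ (1 / (1 - r)) ^ 2 * ‖x‖ ^ 2 :=
      (Finset.sum_le_sum_of_subset_of_nonneg (Finset.range_mono (by lia))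
        fun _ _ _ => sq_nonneg _).trans (sum_state_apply_sq_le hr0 hr1 hA x i)
    have h2 : ∑ t ∈ Finset.range n, state A (extend x) (t + l) j ^ 2 ≤
        (1 / (1 - r)) ^ 2 * ‖x‖ ^ 2 := by
      refine le_trans ?_ (sum_state_apply_sq_le hr0 hr1 hA x j)
      rw [show Finset.range T = Finset.range (l + n) by rw [← hn, add_comm], Finset.sum_range_add]
      simp only [add_comm _ l]
      exact le_add_of_nonneg_left (Finset.sum_nonneg fun _ _ => sq_nonneg _)
    have h3 : ∑ t ∈ Finset.range n, |state A (extend x) t i * state A (extend x) (t + l) j| ≤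
        ∑ t ∈ Finset.range n,
          (1 / 2 * state A (extend x) t i ^ 2 + 1 / 2 * state A (extend x) (t + l) j ^ 2) := by
      refine Finset.sum_le_sum fun t _ => ?_
      rw [abs_mul, ← sq_abs (state A (extend x) t i), ← sq_abs (state A (extend x) (t + l) j)]
      nlinarith [sq_nonneg (|state A (extend x) t i| - |state A (extend x) (t + l) j|)]
    rw [Finset.sum_add_distrib, ← Finset.mul_sum, ← Finset.mul_sum] at h3
    linarith
  · intro t ht
    have := Finset.mem_range.mp ht
    have h1 := norm_impulse_sq_le hr0 hr1 hA (show t < T by lia) i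
    have h2 := norm_impulse_sq_le hr0 hr1 hA (show t + l < T by lia) j
    nlinarith [sq_nonneg (‖impulse A T t i‖ - ‖impulse A T (t + l) j‖)]

end PartialObs

/-! ### Transfer to the given noise; the spectral radius as contraction factor. -/

namespace PartialObs

variable {ι : Type*} [Fintype ι] [DecidableEq ι] {Ω : Type*} [MeasurableSpace Ω]

/-- Compare characteristic functions: independence turns the left one into a product of factors
exp(-σ²‖t s‖²/2). -/
theorem map_noise_eq {P : Measure Ω} [IsProbabilityMeasure P] {σ : ℝ}
    {ξ : ℕ → Ω → EuclideanSpace ℝ ι} (hindep : iIndepFun ξ P)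
    (hlaw : ∀ t, HasLaw (ξ t) (multivariateGaussian 0 (σ ^ 2 • (1 : Matrix ι ι ℝ))) P) (T : ℕ) :
    P.map (fun ω => (WithLp.toLp 2 (fun s : Fin T => ξ s ω) : NoiseSpace T ι)) =
      (stdGaussian (NoiseSpace T ι)).map (σ • ·) := by
  have hm : ∀ s, AEMeasurable (ξ s) P := fun s => (hlaw s).aemeasurable
  have hm' : AEMeasurable
      (fun ω => (WithLp.toLp 2 (fun s : Fin T => ξ s ω) : NoiseSpace T ι)) P := by
    have : AEMeasurable (fun ω => fun s : Fin T => ξ s ω) P := aemeasurable_pi_lambda _ fun s => hm s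
    fun_prop
  have hind : iIndepFun (fun s : Fin T => ξ s) P := hindep.precomp Fin.val_injective
  have : IsProbabilityMeasure (P.map
      (fun ω => (WithLp.toLp 2 (fun s : Fin T => ξ s ω) : NoiseSpace T ι))) :=
    Measure.isProbabilityMeasure_map hm'
  have : IsProbabilityMeasure ((stdGaussian (NoiseSpace T ι)).map (σ • ·)) :=
    Measure.isProbabilityMeasure_map (by fun_prop)
  have hpsd : (σ ^ 2 • (1 : Matrix ι ι ℝ)).PosSemidef :=
    Matrix.PosSemidef.one.smul (sq_nonneg σ)
  apply Measure.ext_of_charFun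
  ext t
  rw [(iIndepFun_iff_charFun_pi fun s : Fin T => hm s).mp hind t, charFun_map_smul,
    charFun_stdGaussian]
  simp_rw [fun s : ℕ => (hlaw s).map_eq, charFun_multivariateGaussian hpsd]
  rw [← Complex.exp_sum]
  congr 1
  have h1 : ∀ s : Fin T, (WithLp.ofLp (t s)) ⬝ᵥ (WithLp.ofLp (t s)) = ‖t s‖ ^ 2 := by
    intro s
    rw [EuclideanSpace.norm_sq_eq]
    simp [dotProduct, sq]
  have h2 : ‖σ • t‖ ^ 2 = ∑ s, σ ^ 2 * ‖t s‖ ^ 2 := by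
    rw [norm_smul, mul_pow, PiLp.norm_sq_eq_of_L2, Real.norm_eq_abs, sq_abs, Finset.mul_sum]
  rw [← Complex.ofReal_pow, h2]
  simp only [inner_zero_right, Complex.ofReal_zero, zero_mul, zero_sub, Matrix.smul_mulVec,
    Matrix.one_mulVec, dotProduct_smul, h1, smul_eq_mul]
  rw [Finset.sum_neg_distrib, ← Finset.sum_div, neg_div, Complex.ofReal_sum]

/-- Concentration of the lag-`l` autocovariances of the state. -/
theorem autocov_tail {P : Measure Ω} [IsProbabilityMeasure P] {σ : ℝ}
    {ξ : ℕ → Ω → EuclideanSpace ℝ ι} (hindep : iIndepFun ξ P) (hσ : σ ≠ 0)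
    (hlaw : ∀ t, HasLaw (ξ t) (multivariateGaussian 0 (σ ^ 2 • (1 : Matrix ι ι ℝ))) P)
    {A : Matrix ι ι ℝ} (hAs : A.IsSymm) {r : ℝ} (hr0 : 0 ≤ r)
    (hr1 : r < 1) (hA : Contracts A r) {θ : ℝ} (hθ0 : 0 ≤ θ) (hθ1 : θ ≤ 1) {T n l : ℕ}
    (hn : n + l = T) (i j : ι) :
    P.real {ω | σ ^ 2 * (n * (1 / (1 - r)) ^ 2 * θ) ≤
      |∑ t ∈ Finset.range n, state A (fun s => ξ s ω) t i * state A (fun s => ξ s ω) (t + l) j -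
        σ ^ 2 * ∑ t ∈ Finset.range n, ∑ k ∈ Finset.range t, (A ^ (2 * k + l)) i j|} ≤
      2 * Real.exp (-(n * θ ^ 2 / 12)) := by
  refine le_of_eq_of_le ?_ (stdGaussian_autocov_tail hAs hr0 hr1 hA hθ0 hθ1 hn i j)
  have hm' : AEMeasurable
      (fun ω => (WithLp.toLp 2 (fun s : Fin T => ξ s ω) : NoiseSpace T ι)) P := by
    have : AEMeasurable (fun ω => fun s : Fin T => ξ s ω) P :=
      aemeasurable_pi_lambda _ fun s => (hlaw s).aemeasurable
    fun_prop
  -- In this form continuity and homogeneity of degree 2 are evident; the latter yields the factor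
  -- σ².
  set F : NoiseSpace T ι → ℝ := fun x => ∑ t ∈ Finset.range n,
    inner ℝ (impulse A T t i) x * inner ℝ (impulse A T (t + l) j) x with hF
  have hFc : Continuous F := by fun_prop
  have hFs : ∀ x, F x = ∑ t ∈ Finset.range n, state A (extend x) t i *
      state A (extend x) (t + l) j := by
    intro x
    refine Finset.sum_congr rfl fun t ht => ?_
    have := Finset.mem_range.mp ht
    rw [inner_impulse A (by lia), inner_impulse A (by lia)]
  have hFξ : ∀ ω, ∑ t ∈ Finset.range n, state A (fun s => ξ s ω) t i *
      state A (fun s => ξ s ω) (t + l) j = F (WithLp.toLp 2 (fun s : Fin T => ξ s ω)) := by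
    intro ω
    rw [hFs]
    refine Finset.sum_congr rfl fun t ht => ?_
    have := Finset.mem_range.mp ht
    have hξ : ∀ s < T, ξ s ω = extend (WithLp.toLp 2 (fun s : Fin T => ξ s ω)) s := by
      intro s hs
      simp [extend, hs]
    rw [state_congr A hξ t (by lia), state_congr A hξ (t + l) (by lia)]
  have hFσ : ∀ x, F (σ • x) = σ ^ 2 * F x := by
    intro x
    simp only [hF, inner_smul_right, Finset.mul_sum]
    exact Finset.sum_congr rfl fun t _ => by ring
  set m := ∑ t ∈ Finset.range n, ∑ k ∈ Finset.range t, (A ^ (2 * k + l)) i j with hmdef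
  set a := (n : ℝ) * (1 / (1 - r)) ^ 2 * θ with ha
  have hS : MeasurableSet {x : NoiseSpace T ι | σ ^ 2 * a ≤ |F x - σ ^ 2 * m|} :=
    measurableSet_le measurable_const (by fun_prop)
  have h := map_measureReal_apply_of_aemeasurable hm' hS
  simp only [hFξ, ← hFs]
  rw [show {ω | σ ^ 2 * a ≤ |F (WithLp.toLp 2 (fun s : Fin T => ξ s ω)) - σ ^ 2 * m|} =
    (fun ω => (WithLp.toLp 2 (fun s : Fin T => ξ s ω) : NoiseSpace T ι)) ⁻¹'
      {x | σ ^ 2 * a ≤ |F x - σ ^ 2 * m|} from rfl, ← h, map_noise_eq hindep hlaw,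
    map_measureReal_apply (by fun_prop) hS]
  congr 1
  ext x
  have hσ2 : 0 < σ ^ 2 := by positivity
  change σ ^ 2 * a ≤ |F (σ • x) - σ ^ 2 * m| ↔ a ≤ |F x - m|
  rw [hFσ, ← mul_sub, abs_mul, abs_of_pos hσ2, mul_le_mul_iff_right₀ hσ2]

open scoped Matrix.Norms.L2Operator in
-- The complexified matrix is self-adjoint, so its spectral radius is its ℓ² operator norm, and real
-- vectors embed isometrically.
theorem contracts_rho {A : Matrix ι ι ℝ} (hA : A.IsSymm) : Contracts A (rho A).toReal := by
  set Ac : Matrix ι ι ℂ := A.map (fun a : ℝ => (a : ℂ)) with hAc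
  have hsa : IsSelfAdjoint Ac := by
    ext i j
    simp [Ac, Matrix.star_apply, hA.apply]
  have hrho : (rho A).toReal = ‖Ac‖ := by
    have h := hsa.spectralRadius_eq_nnnorm
    rw [rho, h]
    simp
  intro v
  have h := Matrix.l2_opNorm_mulVec Ac (WithLp.toLp 2 fun k => (v k : ℂ))
  rw [hrho]
  have hn : ∀ w : ι → ℝ, ‖(WithLp.toLp 2 fun k => (w k : ℂ) : EuclideanSpace ℂ ι)‖ =
      ‖(WithLp.toLp 2 w : EuclideanSpace ℝ ι)‖ := by
    intro w
    simp [EuclideanSpace.norm_eq]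
  rw [hn] at h
  refine le_of_eq_of_le ?_ h
  rw [← hn]
  congr 2
  ext i
  simp [Ac, Matrix.mulVec, dotProduct]

theorem Contracts.abs_pow_apply_le {A : Matrix ι ι ℝ} {r : ℝ} (hr0 : 0 ≤ r) (hA : Contracts A r)
    (k : ℕ) (i j : ι) : |(A ^ k) i j| ≤ r ^ k := by
  have h : ∀ k, ‖WithLp.toLp 2 ((A ^ k).mulVec (Pi.single j 1))‖ ≤ r ^ k := by
    intro k
    induction k with
    | zero => rw [pow_zero, pow_zero, Matrix.one_mulVec]; simp
    | succ k ih =>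
      rw [pow_succ', ← Matrix.mulVec_mulVec, pow_succ']
      exact (hA _).trans (mul_le_mul_of_nonneg_left ih hr0)
  have h1 := (PiLp.norm_apply_le _ i).trans (h k)
  simpa using h1

end PartialObs

/-! ### Bias, perturbation bounds and block algebra. -/

namespace PartialObs

theorem sum_range_sum_range (f : ℕ → ℝ) (n : ℕ) :
    ∑ t ∈ Finset.range n, ∑ k ∈ Finset.range t, f k =
      ∑ k ∈ Finset.range n, ((n : ℝ) - 1 - k) * f k := by
  induction n with
  | zero => simp
  | succ n ih =>
    rw [Finset.sum_range_succ, ih, ← Finset.sum_add_distrib, Finset.sum_range_succ]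
    push_cast
    simp only [add_sub_cancel_right, sub_self, zero_mul, add_zero]
    exact Finset.sum_congr rfl fun k _ => by ring

/-- The bias caused by the deterministic initial state. -/
theorem abs_autocov_mean_sub_le {a : ℕ → ℝ} {r : ℝ} (hr0 : 0 ≤ r) (hr1 : r < 1)
    (ha : ∀ k, |a k| ≤ r ^ k) {p : ℕ} (hp : 1 ≤ p) :
    |1 / ((p : ℝ) + 2) * ∑ t ∈ Finset.range (p + 2), ∑ k ∈ Finset.range t, a k -
      1 / (p : ℝ) * ∑ t ∈ Finset.range p, ∑ k ∈ Finset.range t, a (k + 1) - a 0| ≤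
      1 / ((p : ℝ) + 2) * (1 / (1 - r)) := by
  have hp' : (0 : ℝ) < p := by exact_mod_cast hp
  have h1 : ∑ t ∈ Finset.range (p + 2), ∑ k ∈ Finset.range t, a k =
      ∑ k ∈ Finset.range (p + 1), ((p : ℝ) + 1 - k) * a k := by
    rw [sum_range_sum_range, Finset.sum_range_succ]
    push_cast
    rw [show ((p : ℝ) + 2 - 1 - (p + 1)) = 0 by ring, zero_mul, add_zero]
    exact Finset.sum_congr rfl fun k _ => by ring
  have h2 : ∑ t ∈ Finset.range p, ∑ k ∈ Finset.range t, a (k + 1) =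
      ∑ k ∈ Finset.range (p + 1), ((p : ℝ) - k) * a k - p * a 0 := by
    rw [sum_range_sum_range (fun k => a (k + 1)), Finset.sum_range_succ']
    push_cast
    rw [sub_zero, add_sub_cancel_right]
    exact Finset.sum_congr rfl fun k _ => by ring
  -- After reindexing, a k has weight (p+1-k)/(p+2) in the first average and (p-k)/p in the second,
  -- apart from the missing a 0. The weights differ by (2k-p)/(p(p+2)), at most 1/(p+2) in modulus.
  have h3 : 1 / ((p : ℝ) + 2) * ∑ t ∈ Finset.range (p + 2), ∑ k ∈ Finset.range t, a k -
      1 / (p : ℝ) * ∑ t ∈ Finset.range p, ∑ k ∈ Finset.range t, a (k + 1) - a 0 =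
      ∑ k ∈ Finset.range (p + 1), ((2 * k - p) / (p * (p + 2))) * a k := by
    rw [h1, h2, mul_sub, ← mul_assoc (1 / (p : ℝ)), one_div_mul_cancel hp'.ne', one_mul,
      Finset.mul_sum, Finset.mul_sum, sub_sub, sub_add_cancel, ← Finset.sum_sub_distrib]
    refine Finset.sum_congr rfl fun k _ => ?_
    field_simp
    ring
  rw [h3]
  have h4 : ∑ k ∈ Finset.range (p + 1), r ^ k ≤ 1 / (1 - r) := by
    rw [one_div, ← tsum_geometric_of_lt_one hr0 hr1]
    exact (summable_geometric_of_lt_one hr0 hr1).sum_le_tsum _ fun k _ => pow_nonneg hr0 k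
  calc _ ≤ ∑ k ∈ Finset.range (p + 1), |((2 * k - p) / (p * (p + 2))) * a k| :=
        Finset.abs_sum_le_sum_abs _ _
    _ ≤ ∑ k ∈ Finset.range (p + 1), 1 / ((p : ℝ) + 2) * r ^ k := by
        refine Finset.sum_le_sum fun k hk => ?_
        have hk' : (k : ℝ) ≤ p := by
          exact_mod_cast Nat.lt_succ_iff.mp (Finset.mem_range.mp hk)
        have hk0 : (0 : ℝ) ≤ k := Nat.cast_nonneg k
        rw [abs_mul]
        refine mul_le_mul ?_ (ha k) (abs_nonneg _) (by positivity)
        rw [abs_div, abs_of_pos (show (0 : ℝ) < p * (p + 2) by positivity),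
          div_le_div_iff₀ (by positivity) (by positivity)]
        have : |2 * (k : ℝ) - p| ≤ p := by rw [abs_le]; constructor <;> linarith
        nlinarith
    _ ≤ _ := by
        rw [← Finset.mul_sum]
        gcongr

theorem momentEst_apply {n : ℕ} (y : ℕ → Fin n → ℝ) (p m : ℕ) (i j : Fin n) :
    momentEst (p + m + 2) y m i j =
      1 / ((p : ℝ) + 2) * ∑ t ∈ Finset.range (p + 2), y t i * y (t + m) j -
      1 / (p : ℝ) * ∑ t ∈ Finset.range p, y t i * y (t + (m + 2)) j := by
  have h1 : p + m + 2 - m = p + 2 := by lia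
  have h2 : p + 2 - 2 = p := by lia
  have h3 : ((p + m + 2 : ℕ) : ℝ) - m = p + 2 := by push_cast; ring
  have h4 : (p : ℝ) + 2 - 2 = p := by ring
  rw [momentEst, h1, h2, h3, h4]
  simp only [Matrix.sub_apply, Matrix.smul_apply, Matrix.sum_apply, Matrix.vecMulVec_apply,
    smul_eq_mul, add_assoc]

/-- The moment estimator is accurate when the empirical autocovariances are near their means. -/
theorem abs_momentEst_sub_le {n : ℕ} {y : ℕ → Fin n → ℝ} {a : ℕ → ℝ} {r s d : ℝ} (hr0 : 0 ≤ r)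
    (hr1 : r < 1) (ha : ∀ k, |a k| ≤ r ^ k) (hs : 0 ≤ s) {p m : ℕ} (hp : 1 ≤ p) (i j : Fin n)
    (h1 : |∑ t ∈ Finset.range (p + 2), y t i * y (t + m) j -
      s * ∑ t ∈ Finset.range (p + 2), ∑ k ∈ Finset.range t, a k| ≤ s * (((p : ℝ) + 2) * d))
    (h2 : |∑ t ∈ Finset.range p, y t i * y (t + (m + 2)) j -
      s * ∑ t ∈ Finset.range p, ∑ k ∈ Finset.range t, a (k + 1)| ≤ s * (p * d)) :
    |momentEst (p + m + 2) y m i j - s * a 0| ≤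
      s * (2 * d + 1 / ((p : ℝ) + 2) * (1 / (1 - r))) := by
  have hp' : (0 : ℝ) < p := by exact_mod_cast hp
  have h3 := mul_le_mul_of_nonneg_left (abs_autocov_mean_sub_le hr0 hr1 ha hp) hs
  rw [momentEst_apply]
  set X := ∑ t ∈ Finset.range (p + 2), y t i * y (t + m) j
  set Y := ∑ t ∈ Finset.range p, y t i * y (t + (m + 2)) j
  set U := ∑ t ∈ Finset.range (p + 2), ∑ k ∈ Finset.range t, a k
  set W := ∑ t ∈ Finset.range p, ∑ k ∈ Finset.range t, a (k + 1)
  have e : 1 / ((p : ℝ) + 2) * X - 1 / (p : ℝ) * Y - s * a 0 =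
      1 / ((p : ℝ) + 2) * (X - s * U) - 1 / (p : ℝ) * (Y - s * W) +
        s * (1 / ((p : ℝ) + 2) * U - 1 / (p : ℝ) * W - a 0) := by ring
  have h4 : |1 / ((p : ℝ) + 2) * (X - s * U)| ≤ s * d := by
    rw [abs_mul, abs_of_pos (by positivity), one_div_mul_eq_div, div_le_iff₀ (by positivity)]
    linarith
  have h5 : |1 / (p : ℝ) * (Y - s * W)| ≤ s * d := by
    rw [abs_mul, abs_of_pos (by positivity), one_div_mul_eq_div, div_le_iff₀ (by positivity)]
    linarith
  have h6 : |s * (1 / ((p : ℝ) + 2) * U - 1 / (p : ℝ) * W - a 0)| ≤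
      s * (1 / ((p : ℝ) + 2) * (1 / (1 - r))) := by
    rw [abs_mul, abs_of_nonneg hs]
    exact h3
  rw [e]
  calc _ ≤ _ := (abs_add_le _ _).trans (add_le_add (abs_sub _ _) h6)
    _ ≤ _ := by linarith

theorem abs_mul_sub_mul_apply_le {n : ℕ} {K L M M' : Matrix (Fin n) (Fin n) ℝ}
    {p q α β : ℝ} (hα : 0 ≤ α) (hp : 0 ≤ p) (hKM : ∀ i j, |K i j - M i j| ≤ p)
    (hLM : ∀ i j, |L i j - M' i j| ≤ q) (hM : ∀ i j, |M i j| ≤ α)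
    (hL : ∀ i j, |L i j| ≤ β) (i j : Fin n) :
    |(K * L) i j - (M * M') i j| ≤ n * (p * β + α * q) := by
  rw [Matrix.mul_apply, Matrix.mul_apply, ← Finset.sum_sub_distrib]
  refine (Finset.abs_sum_le_sum_abs _ _).trans ?_
  calc _ ≤ ∑ k : Fin n, (p * β + α * q) := by
        refine Finset.sum_le_sum fun k _ => ?_
        rw [show K i k * L k j - M i k * M' k j =
          (K i k - M i k) * L k j + M i k * (L k j - M' k j) by ring]
        refine (abs_add_le _ _).trans ?_
        rw [abs_mul, abs_mul]
        exact add_le_add (mul_le_mul (hKM i k) (hL k j) (abs_nonneg _) hp)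
          (mul_le_mul (hM i k) (hLM k j) (abs_nonneg _) hα)
    _ = _ := by rw [Finset.sum_const, Finset.card_univ, Fintype.card_fin, nsmul_eq_mul]

theorem abs_mul_apply_le {n : ℕ} {K L : Matrix (Fin n) (Fin n) ℝ} {α β : ℝ}
    (hα : 0 ≤ α) (hK : ∀ i j, |K i j| ≤ α) (hL : ∀ i j, |L i j| ≤ β) (i j : Fin n) :
    |(K * L) i j| ≤ n * (α * β) := by
  rw [Matrix.mul_apply]
  refine (Finset.abs_sum_le_sum_abs _ _).trans ?_
  calc _ ≤ ∑ k : Fin n, α * β := Finset.sum_le_sum fun k _ => by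
        rw [abs_mul]
        exact mul_le_mul (hK i k) (hL k j) (abs_nonneg _) hα
    _ = _ := by simp

theorem abs_apply_le_add {n : ℕ} {K M : Matrix (Fin n) (Fin n) ℝ} {p α : ℝ}
    (hKM : ∀ i j, |K i j - M i j| ≤ p) (hM : ∀ i j, |M i j| ≤ α) (i j : Fin n) :
    |K i j| ≤ α + p := by
  have h := abs_add_le (M i j) (K i j - M i j)
  rw [add_sub_cancel] at h
  exact h.trans (add_le_add (hM i j) (hKM i j))

section Perturbation

variable {n : ℕ} {K₁ K₂ K₃ M₁ M₂ M₃ : Matrix (Fin n) (Fin n) ℝ} {b : ℝ}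

/-- From K L - M M' = (K - M) L + M (L - M') the error is at most b + n(b(1+b) + b), and n b ≤ 1/10
absorbs the quadratic term. -/
theorem abs_sub_sq_sub_le (hn : 1 ≤ n) (hb : 0 ≤ b) (hnb : n * b ≤ 1 / 10)
    (h₁ : ∀ i j, |K₁ i j - M₁ i j| ≤ b) (h₂ : ∀ i j, |K₂ i j - M₂ i j| ≤ b)
    (hM₁ : ∀ i j, |M₁ i j| ≤ 1) (i j : Fin n) :
    |(K₂ - K₁ ^ 2) i j - (M₂ - M₁ ^ 2) i j| ≤ 4 * n * b := by
  have hn' : (1 : ℝ) ≤ n := by exact_mod_cast hn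
  have hb1 : b ≤ 1 / 10 := by nlinarith
  have h3 := abs_mul_sub_mul_apply_le zero_le_one hb h₁ h₁ hM₁ (abs_apply_le_add h₁ hM₁) i j
  rw [Matrix.sub_apply, Matrix.sub_apply, sq, sq,
    show K₂ i j - (K₁ * K₁) i j - (M₂ i j - (M₁ * M₁) i j) =
      (K₂ i j - M₂ i j) - ((K₁ * K₁) i j - (M₁ * M₁) i j) by ring]
  refine (abs_sub _ _).trans ((add_le_add (h₂ i j) h3).trans ?_)
  have : n * (b * b) ≤ n * b * (1 / 10) := by nlinarith
  nlinarith

/-- In units of n² b, the cube costs at most 4.3, the two mixed products 6.4 and 7, and the third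
moment 1. -/
theorem abs_third_moment_sub_le (hn : 1 ≤ n) (hb : 0 ≤ b) (hnb : n * b ≤ 1 / 10)
    (h₁ : ∀ i j, |K₁ i j - M₁ i j| ≤ b) (h₂ : ∀ i j, |K₂ i j - M₂ i j| ≤ b)
    (h₃ : ∀ i j, |K₃ i j - M₃ i j| ≤ b)
    (hM₁ : ∀ i j, |M₁ i j| ≤ 1) (hM₂ : ∀ i j, |M₂ i j| ≤ 1) (i j : Fin n) :
    |(K₃ - K₁ ^ 3 - (K₂ - K₁ ^ 2) * K₁ - K₁ * (K₂ - K₁ ^ 2)) i j -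
      (M₃ - M₁ ^ 3 - (M₂ - M₁ ^ 2) * M₁ - M₁ * (M₂ - M₁ ^ 2)) i j| ≤ 20 * n ^ 2 * b := by
  have hn' : (1 : ℝ) ≤ n := by exact_mod_cast hn
  have hb1 : b ≤ 1 / 10 := by nlinarith
  have hK₁ : ∀ i j, |K₁ i j| ≤ 11 / 10 := fun i j =>
    (abs_apply_le_add h₁ hM₁ i j).trans (by linarith)
  have hsq : ∀ i j, |(K₁ ^ 2) i j - (M₁ ^ 2) i j| ≤ 3 * n * b := by
    intro i j
    rw [sq, sq]
    refine (abs_mul_sub_mul_apply_le zero_le_one hb h₁ h₁ hM₁ hK₁ i j).trans ?_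
    nlinarith
  have hMsq : ∀ i j, |(M₁ ^ 2) i j| ≤ n := by
    intro i j
    rw [sq]
    exact (abs_mul_apply_le zero_le_one hM₁ hM₁ i j).trans (by simp)
  have hcube := abs_mul_sub_mul_apply_le (by positivity) (by positivity) hsq h₁ hMsq hK₁ i j
  have hD := abs_sub_sq_sub_le hn hb hnb h₁ h₂ hM₁
  have hMD : ∀ i j, |(M₂ - M₁ ^ 2) i j| ≤ 2 * n := by
    intro i j
    rw [Matrix.sub_apply]
    exact (abs_sub _ _).trans (by linarith [hM₂ i j, hMsq i j])
  have hKD : ∀ i j, |(K₂ - K₁ ^ 2) i j| ≤ 3 * n := fun i j =>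
    (abs_apply_le_add hD hMD i j).trans (by linarith)
  have hl := abs_mul_sub_mul_apply_le (by positivity) (by positivity) hD h₁ hMD hK₁ i j
  have hr := abs_mul_sub_mul_apply_le zero_le_one hb h₁ hD hM₁ hKD i j
  rw [← pow_succ, ← pow_succ] at hcube
  set X := K₂ - K₁ ^ 2
  set Z := M₂ - M₁ ^ 2
  simp only [Matrix.sub_apply]
  rw [show K₃ i j - (K₁ ^ 3) i j - (X * K₁) i j - (K₁ * X) i j -
      (M₃ i j - (M₁ ^ 3) i j - (Z * M₁) i j - (M₁ * Z) i j) =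
      (K₃ i j - M₃ i j) - ((K₁ ^ 3) i j - (M₁ ^ 3) i j) - ((X * K₁) i j - (Z * M₁) i j) -
        ((K₁ * X) i j - (M₁ * Z) i j) by ring]
  refine (abs_sub _ _).trans ((add_le_add ((abs_sub _ _).trans (add_le_add
    ((abs_sub _ _).trans (add_le_add (h₃ i j) hcube)) hl)) hr).trans ?_)
  have : b ≤ n ^ 2 * b := le_mul_of_one_le_left hb (one_le_pow₀ hn')
  nlinarith

end Perturbation

section Blocks

variable {no nh : ℕ} (B : Matrix (Fin no) (Fin no) ℝ) (C : Matrix (Fin no) (Fin nh) ℝ)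
    (E : Matrix (Fin nh) (Fin nh) ℝ)

theorem systemMatrix_sq : systemMatrix B C E ^ 2 = Matrix.fromBlocks (B * B + C * C.transpose)
    (B * C + C * E) (C.transpose * B + E * C.transpose) (C.transpose * C + E * E) := by
  rw [sq, systemMatrix, Matrix.fromBlocks_multiply]

/-- A two-step path between observed coordinates stays observed or has a hidden midpoint. -/
theorem toBlocks₁₁_systemMatrix_sq :
    (systemMatrix B C E ^ 2).toBlocks₁₁ - B ^ 2 = C * C.transpose := by
  rw [systemMatrix_sq, Matrix.toBlocks_fromBlocks₁₁, sq, add_sub_cancel_left]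

theorem toBlocks₁₁_systemMatrix_cube :
    (systemMatrix B C E ^ 3).toBlocks₁₁ - B ^ 3 - C * C.transpose * B - B * (C * C.transpose) =
      C * E * C.transpose := by
  rw [pow_succ, systemMatrix_sq, systemMatrix, Matrix.fromBlocks_multiply,
    Matrix.toBlocks_fromBlocks₁₁]
  simp only [pow_succ, pow_zero, one_mul, Matrix.add_mul, Matrix.mul_assoc]
  abel

end Blocks

theorem maxNorm_le {n : ℕ} (hn : 1 ≤ n) {M : Matrix (Fin n) (Fin n) ℝ} {e : ℝ}
    (h : ∀ i j, |M i j| ≤ e) : maxNorm M ≤ e := by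
  have : Nonempty (Fin n) := ⟨⟨0, hn⟩⟩
  exact ciSup_le fun p => h p.1 p.2

/-- Deterministic part: accuracy of the estimators when all four moment estimators are accurate. -/
theorem estimators_accurate {no nh : ℕ} (hno : 1 ≤ no) {B : Matrix (Fin no) (Fin no) ℝ}
    {C : Matrix (Fin no) (Fin nh) ℝ} {E : Matrix (Fin nh) (Fin nh) ℝ} {s η : ℝ} (hs : 0 < s)
    (hη0 : 0 ≤ η) (hη : η ≤ 1 / 2) {T : ℕ} {y : ℕ → Fin no → ℝ}
    (hpow : ∀ m i j, |(systemMatrix B C E ^ m) i j| ≤ 1)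
    (hmom : ∀ m ≤ 3, ∀ i j, |momentEst T y m i j -
      s * (systemMatrix B C E ^ m) (Sum.inl i) (Sum.inl j)| ≤ s * η) :
    |varEst T y - s| ≤ s * η ∧ maxNorm (BEst T y - B) ≤ 4 * η ∧
    (no * (4 * η) ≤ 1 / 10 → maxNorm (CCEst T y - C * C.transpose) ≤ 4 * no * (4 * η) ∧
      maxNorm (CECEst T y - C * E * C.transpose) ≤ 20 * no ^ 2 * (4 * η)) := by
  have hno' : (0 : ℝ) < no := by exact_mod_cast hno
  have hvar : |varEst T y - s| ≤ s * η := by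
    have e : varEst T y - s = 1 / (no : ℝ) * ∑ i, (momentEst T y 0 i i - s) := by
      rw [Finset.sum_sub_distrib, mul_sub, varEst, Matrix.trace]
      simp [hno'.ne']
    have h : |∑ i, (momentEst T y 0 i i - s)| ≤ no * (s * η) := by
      refine (Finset.abs_sum_le_sum_abs _ _).trans ?_
      refine (Finset.sum_le_sum fun i _ => ?_ : _ ≤ ∑ _i : Fin no, s * η).trans_eq (by simp)
      have := hmom 0 (by lia) i i
      rwa [pow_zero, Matrix.one_apply_eq, mul_one] at this
    rw [e, abs_mul, abs_of_pos (by positivity), one_div_mul_eq_div, div_le_iff₀ hno']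
    linarith
  -- Normalising at most doubles relative errors; with moment and variance errors s η each, this
  -- gives 2 · 2η = 4η in `hK`.
  have hv : s / 2 ≤ varEst T y := by nlinarith [(abs_le.mp hvar).1]
  have hv0 : 0 < varEst T y := by linarith
  have hK : ∀ m ≤ 3, ∀ i j, |((1 / varEst T y) • momentEst T y m) i j -
      (systemMatrix B C E ^ m).toBlocks₁₁ i j| ≤ 4 * η := by
    intro m hm i j
    have h1 := hmom m hm i j
    have h2 := hpow m (Sum.inl i) (Sum.inl j)
    rw [Matrix.smul_apply, smul_eq_mul, Matrix.toBlocks₁₁, Matrix.of_apply]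
    set a := (systemMatrix B C E ^ m) (Sum.inl i) (Sum.inl j)
    have e : 1 / varEst T y * momentEst T y m i j - a =
        ((momentEst T y m i j - s * a) - (varEst T y - s) * a) / varEst T y := by
      field_simp
      ring
    rw [e, abs_div, abs_of_pos hv0, div_le_iff₀ hv0]
    have h3 : |(varEst T y - s) * a| ≤ s * η * 1 := by
      rw [abs_mul]
      exact mul_le_mul hvar h2 (abs_nonneg _) (by positivity)
    refine (abs_sub _ _).trans ?_
    nlinarith
  have hM : ∀ m i j, |(systemMatrix B C E ^ m).toBlocks₁₁ i j| ≤ 1 := fun m i j => hpow m _ _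
  have hB : (systemMatrix B C E ^ 1).toBlocks₁₁ = B := by
    rw [pow_one, systemMatrix, Matrix.toBlocks_fromBlocks₁₁]
  have hK1 : ∀ i j, |BEst T y i j - B i j| ≤ 4 * η := by
    have := hK 1 (by lia)
    rwa [hB] at this
  have hB1 : ∀ i j, |B i j| ≤ 1 := by
    have := hM 1
    rwa [hB] at this
  refine ⟨hvar, maxNorm_le hno hK1, fun hsmall => ⟨maxNorm_le hno ?_, maxNorm_le hno ?_⟩⟩
  · intro i j
    rw [← toBlocks₁₁_systemMatrix_sq B C E]
    exact abs_sub_sq_sub_le hno (by positivity) hsmall hK1 (hK 2 (by lia)) hB1 i j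
  · intro i j
    have h := abs_third_moment_sub_le hno (by positivity) hsmall hK1 (hK 2 (by lia))
      (hK 3 (by lia)) hB1 (hM 2) i j
    rwa [toBlocks₁₁_systemMatrix_sq, toBlocks₁₁_systemMatrix_cube] at h

end PartialObs

/-! ### Union bound and sample size arithmetic. -/

namespace PartialObs

/-- All autocovariances up to lag five are simultaneously close to their means. -/
theorem autocov_union {Ω : Type*} [MeasurableSpace Ω] {P : Measure Ω} [IsProbabilityMeasure P]
    {no nh : ℕ} {A : Matrix (Fin no ⊕ Fin nh) (Fin no ⊕ Fin nh) ℝ} {σ : ℝ} (hσ : σ ≠ 0)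
    {ξ : ℕ → Ω → EuclideanSpace ℝ (Fin no ⊕ Fin nh)} (hindep : iIndepFun ξ P)
    (hlaw : ∀ t, HasLaw (ξ t)
      (multivariateGaussian 0 (σ ^ 2 • (1 : Matrix (Fin no ⊕ Fin nh) (Fin no ⊕ Fin nh) ℝ))) P)
    {y : ℕ → Ω → Fin no → ℝ}
    (hy : ∀ t ω, y t ω = observed (state A (fun s => ξ s ω)) t)
    (hAs : A.IsSymm) {r : ℝ} (hr0 : 0 ≤ r) (hr1 : r < 1) (hA : Contracts A r)
    {θ : ℝ} (hθ0 : 0 ≤ θ) (hθ1 : θ ≤ 1) {T : ℕ} (hT : 5 ≤ T) :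
    1 - 12 * (no : ℝ) ^ 2 * Real.exp (-(((T : ℝ) - 5) * θ ^ 2 / 12)) ≤
      P.real {ω | ∀ l : Fin 6, ∀ i j : Fin no,
        |∑ t ∈ Finset.range (T - l), y t ω i * y (t + l) ω j -
          σ ^ 2 * ∑ t ∈ Finset.range (T - l), ∑ k ∈ Finset.range t,
            (A ^ (2 * k + l)) (Sum.inl i) (Sum.inl j)| ≤
        σ ^ 2 * (((T - l : ℕ) : ℝ) * ((1 / (1 - r)) ^ 2 * θ))} := by
  set D : Fin 6 × Fin no × Fin no → Ω → ℝ := fun q ω =>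
    |∑ t ∈ Finset.range (T - q.1), y t ω q.2.1 * y (t + q.1) ω q.2.2 -
          σ ^ 2 * ∑ t ∈ Finset.range (T - q.1), ∑ k ∈ Finset.range t,
            (A ^ (2 * k + q.1)) (Sum.inl q.2.1) (Sum.inl q.2.2)| with hD
  set d : Fin 6 × Fin no × Fin no → ℝ := fun q =>
    σ ^ 2 * (((T - q.1 : ℕ) : ℝ) * ((1 / (1 - r)) ^ 2 * θ)) with hd
  set G := {ω | ∀ l : Fin 6, ∀ i j : Fin no, D (l, i, j) ω ≤ d (l, i, j)} with hG
  change _ ≤ P.real G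
  have hbad : ∀ q, P.real {ω | d q ≤ D q ω} ≤
      2 * Real.exp (-(((T : ℝ) - 5) * θ ^ 2 / 12)) := by
    rintro ⟨l, i, j⟩
    have h := autocov_tail hindep hσ hlaw hAs hr0 hr1 hA hθ0 hθ1
      (show (T - l) + (l : ℕ) = T by lia) (Sum.inl i) (Sum.inl j)
    simp only [hD, hd, hy, observed]
    simp only [mul_assoc] at h ⊢
    refine h.trans ?_
    -- Lags are at most 5, so every sum has at least T - 5 terms.
    have h5 : (T : ℝ) - 5 ≤ ((T - l : ℕ) : ℝ) := by
      have h6 : T ≤ (T - l) + 5 := by lia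
      have h7 : (T : ℝ) ≤ ((T - l : ℕ) : ℝ) + 5 := by exact_mod_cast h6
      linarith
    gcongr
  -- Six lags, no² pairs and two tails give the factor 12 no².
  have hcompl : P.real Gᶜ ≤ 12 * (no : ℝ) ^ 2 * Real.exp (-(((T : ℝ) - 5) * θ ^ 2 / 12)) := by
    calc P.real Gᶜ ≤ P.real (⋃ q, {ω | d q ≤ D q ω}) := by
          refine measureReal_mono (fun ω hω => ?_) (measure_ne_top _ _)
          simp only [hG, Set.mem_compl_iff, Set.mem_ofPred_eq, not_forall, not_le] at hω
          obtain ⟨l, i, j, h⟩ := hω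
          exact Set.mem_iUnion.mpr ⟨(l, i, j), h.le⟩
      _ ≤ ∑ q, P.real {ω | d q ≤ D q ω} := measureReal_iUnion_fintype_le _
      _ ≤ ∑ _q : Fin 6 × Fin no × Fin no, 2 * Real.exp (-(((T : ℝ) - 5) * θ ^ 2 / 12)) :=
          Finset.sum_le_sum fun q _ => hbad q
      _ = _ := by
          simp only [Finset.sum_const, Finset.card_univ, Fintype.card_prod, Fintype.card_fin,
            nsmul_eq_mul]
          push_cast
          ring
  have h1 : 1 ≤ P.real G + P.real Gᶜ := by
    have := measureReal_union_le (μ := P) G Gᶜ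
    rwa [Set.union_compl_self, probReal_univ] at this
  linarith

theorem le_sqrt_log_sample {N δ : ℝ} (hN : 1 ≤ N) (hδ0 : 0 < δ) (hδ1 : δ < 1) :
    7 / 10 ≤ Real.sqrt (Real.log (2 * N ^ 2 / δ)) := by
  have harg : 2 ≤ 2 * N ^ 2 / δ := by
    rw [le_div_iff₀ hδ0]
    nlinarith
  have h1 : Real.log 2 ≤ Real.log (2 * N ^ 2 / δ) := Real.log_le_log two_pos harg
  exact Real.le_sqrt_of_sq_le (by linarith [Real.log_two_gt_d9])

/-- With L the logarithm, the exponent is at least L + 2: the factor 3 in θ makes the coefficient of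
(1 + 2√L)² nearly 9/12. Then 12 N² exp(-L-2) = 6δ/e² ≤ δ. -/
theorem failure_probability_le {N δ τ : ℝ} (hN : 1 ≤ N) (hδ0 : 0 < δ) (hδ1 : δ < 1)
    (hτ : 1024 ≤ τ) :
    12 * N ^ 2 * Real.exp (-((τ - 5) *
      (3 * ((1 + 2 * Real.sqrt (Real.log (2 * N ^ 2 / δ))) / Real.sqrt τ)) ^ 2 / 12)) ≤ δ := by
  set L := Real.log (2 * N ^ 2 / δ) with hL
  have hτ0 : 0 < τ := by linarith
  have hq1 : 7 / 10 ≤ Real.sqrt L := le_sqrt_log_sample hN hδ0 hδ1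
  have hL0 : 0 < L := Real.sqrt_pos.mp (by linarith)
  have hq : Real.sqrt L ^ 2 = L := Real.sq_sqrt hL0.le
  have h1 : L + 2 ≤ (τ - 5) * (3 * ((1 + 2 * Real.sqrt L) / Real.sqrt τ)) ^ 2 / 12 := by
    rw [mul_pow, div_pow, Real.sq_sqrt hτ0.le]
    have h2 : (72 / 100 : ℝ) ≤ (τ - 5) * (3 ^ 2 / τ) / 12 := by
      rw [le_div_iff₀ (by norm_num), mul_div_assoc', le_div_iff₀ hτ0]
      linarith
    calc L + 2 ≤ 72 / 100 * (1 + 2 * Real.sqrt L) ^ 2 := by nlinarith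
      _ ≤ (τ - 5) * (3 ^ 2 / τ) / 12 * (1 + 2 * Real.sqrt L) ^ 2 := by gcongr
      _ = _ := by ring
  have h6 : 6 ≤ Real.exp 2 := by
    have := Real.exp_one_gt_d9
    rw [show (2 : ℝ) = 1 + 1 by norm_num, Real.exp_add]
    nlinarith
  calc _ ≤ 12 * N ^ 2 * Real.exp (-(L + 2)) := by gcongr
    _ = 12 * N ^ 2 * (δ / (2 * N ^ 2)) / Real.exp 2 := by
        rw [neg_add, Real.exp_add, Real.exp_neg, Real.exp_neg, hL, Real.exp_log (by positivity),
          inv_div]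
        ring
    _ = 6 * δ / Real.exp 2 := by
        have : N ≠ 0 := by linarith
        field_simp
        ring
    _ ≤ δ := by
        rw [div_le_iff₀ (Real.exp_pos 2)]
        nlinarith

/-- Inverts the sample size condition. The two entries of κ are the squares of 8σ² and 32, the
prefactors of the variance error and of the normalised moment error. -/
theorem of_sampleSize_le {σ ε δ r τ K : ℝ} {N : ℕ} (hε : 0 < ε) (hr1 : r < 1) (hτ : 0 < τ)
    (h : K ^ 2 * sampleSize σ ε δ r N ≤ τ) :
    K * (8 * σ ^ 2 * ((1 / (1 - r)) ^ 2 *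
      ((1 + 2 * Real.sqrt (Real.log (2 * (N : ℝ) ^ 2 / δ))) / Real.sqrt τ))) ≤ ε ∧
    K * (32 * ((1 / (1 - r)) ^ 2 *
      ((1 + 2 * Real.sqrt (Real.log (2 * (N : ℝ) ^ 2 / δ))) / Real.sqrt τ))) ≤ ε := by
  have hr : 0 < 1 - r := by linarith
  rw [sampleSize] at h
  set S := 1 + 2 * Real.sqrt (Real.log (2 * (N : ℝ) ^ 2 / δ)) with hS
  have hS0 : 0 ≤ S := by positivity
  have key : ∀ a : ℝ, 0 ≤ a → a ^ 2 ≤ kappa σ →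
      K * (a * ((1 / (1 - r)) ^ 2 * (S / Real.sqrt τ))) ≤ ε := by
    intro a ha hak
    refine le_of_sq_le_sq ?_ hε.le
    have e : (K * (a * ((1 / (1 - r)) ^ 2 * (S / Real.sqrt τ)))) ^ 2 =
        K ^ 2 * (a ^ 2 * S ^ 2 / (1 - r) ^ 4) / τ := by
      rw [mul_pow, mul_pow, mul_pow, div_pow S, Real.sq_sqrt hτ.le]
      field_simp
    rw [e, div_le_iff₀ hτ]
    calc K ^ 2 * (a ^ 2 * S ^ 2 / (1 - r) ^ 4) ≤ K ^ 2 * (kappa σ * S ^ 2 / (1 - r) ^ 4) := by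
          gcongr
      _ = ε ^ 2 * (K ^ 2 * (kappa σ * S ^ 2 / (ε ^ 2 * (1 - r) ^ 4))) := by field_simp
      _ ≤ ε ^ 2 * τ := by gcongr
  refine ⟨key (8 * σ ^ 2) (by positivity) ?_, key 32 (by norm_num) (le_max_right _ _)⟩
  refine le_of_eq_of_le ?_ (le_max_left _ _)
  ring

end PartialObs

/-! ### Assembly. -/

theorem corollary1 {Ω : Type*} [MeasurableSpace Ω] (P : Measure Ω) [IsProbabilityMeasure P]
    (no nh : ℕ) (hno : 1 ≤ no)
    (B : Matrix (Fin no) (Fin no) ℝ) (C : Matrix (Fin no) (Fin nh) ℝ)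
    (E : Matrix (Fin nh) (Fin nh) ℝ)
    (hA : (PartialObs.systemMatrix B C E).IsSymm)
    (hρ : PartialObs.rho (PartialObs.systemMatrix B C E) < 1)
    (σ : ℝ) (ξ : ℕ → Ω → EuclideanSpace ℝ (Fin no ⊕ Fin nh))
    (hindep : iIndepFun ξ P)
    (hlaw : ∀ t, HasLaw (ξ t)
      (multivariateGaussian 0 (σ ^ 2 • (1 : Matrix (Fin no ⊕ Fin nh) (Fin no ⊕ Fin nh) ℝ))) P)
    (y : ℕ → Ω → Fin no → ℝ)
    (hy : ∀ t ω, y t ω =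
      PartialObs.observed (PartialObs.state (PartialObs.systemMatrix B C E) (fun s => ξ s ω)) t)
    (r : ℝ) (hr : r = (PartialObs.rho (PartialObs.systemMatrix B C E)).toReal)
    (N : ℕ) (hN : N = no + nh)
    (ε δ : ℝ) (hε : 0 < ε) (hεσ : ε < σ ^ 2 / 2) (hδ : 0 < δ) (T : ℕ) :
    1 - δ ≤ P.real {ω |
      (max (PartialObs.sampleSize σ ε δ r N) 6 ≤ (T : ℝ) →
        |PartialObs.varEst T (fun t => y t ω) - σ ^ 2| ≤ ε ∧
        PartialObs.maxNorm (PartialObs.BEst T (fun t => y t ω) - B) ≤ ε) ∧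
      (max (20 ^ 2 * (N : ℝ) ^ 2 * PartialObs.sampleSize σ ε δ r N) 8 ≤ (T : ℝ) →
        PartialObs.maxNorm (PartialObs.CCEst T (fun t => y t ω) - C * C.transpose) ≤ ε) ∧
      (max (140 ^ 2 * (N : ℝ) ^ 4 * PartialObs.sampleSize σ ε δ r N) 10 ≤ (T : ℝ) →
        PartialObs.maxNorm (PartialObs.CECEst T (fun t => y t ω) - C * E * C.transpose) ≤ ε)} := by
  have hP1 : ∀ S : Set Ω, S = Set.univ → 1 - δ ≤ P.real S := by
    rintro S rfl
    rw [probReal_univ]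
    linarith
  rcases le_or_gt 1 δ with hδ1 | hδ1
  · exact (sub_nonpos.mpr hδ1).trans measureReal_nonneg
  have hno1 : (1 : ℝ) ≤ no := by exact_mod_cast hno
  have hnoN : (no : ℝ) ≤ N := by rw [hN]; push_cast; linarith [Nat.cast_nonneg (α := ℝ) nh]
  have hN1 : (1 : ℝ) ≤ N := hno1.trans hnoN
  have hr0 : 0 ≤ r := hr ▸ ENNReal.toReal_nonneg
  have hr1 : r < 1 := by
    rw [hr]
    exact (ENNReal.toReal_lt_toReal (ne_top_of_lt hρ) ENNReal.one_ne_top).mpr hρ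
  have h1r : 0 < 1 - r := by linarith
  have hs : 0 < σ ^ 2 := by linarith
  have hσ : σ ≠ 0 := fun h => by simp [h] at hs
  have hcontr : PartialObs.Contracts (PartialObs.systemMatrix B C E) r :=
    hr ▸ PartialObs.contracts_rho hA
  have hq := PartialObs.le_sqrt_log_sample hN1 hδ hδ1
  have hκ : 0 < PartialObs.kappa σ := lt_of_lt_of_le (by norm_num) (le_max_right _ _)
  have hss : 0 < PartialObs.sampleSize σ ε δ r N := by
    rw [PartialObs.sampleSize]
    positivity
  -- Below the basic sample size all three premises fail and the event is everything.
  rcases lt_or_ge (T : ℝ) (PartialObs.sampleSize σ ε δ r N) with hT | hT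
  · refine hP1 _ (Set.eq_univ_of_forall fun ω => ⟨fun h => ?_, fun h => ?_, fun h => ?_⟩)
    · exact absurd ((le_max_left _ _).trans h) (not_le.mpr hT)
    · refine absurd ((le_max_left _ _).trans h) (not_le.mpr (hT.trans_le ?_))
      exact le_mul_of_one_le_left hss.le (by nlinarith)
    · refine absurd ((le_max_left _ _).trans h) (not_le.mpr (hT.trans_le ?_))
      exact le_mul_of_one_le_left hss.le (by nlinarith [one_le_pow₀ hN1 (n := 4)])
  have hT0 : (0 : ℝ) < T := hss.trans_le hT
  have hmain := fun (K : ℝ) (h : K ^ 2 * PartialObs.sampleSize σ ε δ r N ≤ T) =>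
    PartialObs.of_sampleSize_le hε hr1 hT0 h
  have htail := PartialObs.failure_probability_le (τ := T) hN1 hδ hδ1
  set w := (1 + 2 * Real.sqrt (Real.log (2 * (N : ℝ) ^ 2 / δ))) / Real.sqrt T with hw
  set c := (1 / (1 - r)) ^ 2 with hc
  have hsqT : 0 < Real.sqrt T := Real.sqrt_pos.mpr hT0
  have hw0 : 0 < w := by positivity
  have hinv : 1 ≤ 1 / (1 - r) := by rw [le_div_iff₀ h1r]; linarith
  have hc1 : 1 / (1 - r) ≤ c := by rw [hc, sq]; exact le_mul_of_one_le_left (by positivity) hinv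
  have hcw : w ≤ c * w := le_mul_of_one_le_left hw0.le (hinv.trans hc1)
  -- From 8σ² K c w ≤ ε < σ²/2.
  have hsmall : ∀ K : ℝ, K ^ 2 * PartialObs.sampleSize σ ε δ r N ≤ T → K * (c * w) < 1 / 16 := by
    intro K h
    have h1 := (hmain K h).1
    nlinarith
  have hsmall1 : c * w < 1 / 16 := by
    have := hsmall 1 (by linarith)
    linarith
  -- The numerator of w is at least 1 + 2 · 0.7, and 16 · 2.4 = 38.4.
  have hsqT38 : 38 ≤ Real.sqrt T := by
    have h1 : w < 1 / 16 := by linarith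
    rw [hw, div_lt_iff₀ hsqT] at h1
    linarith
  have hTsq : Real.sqrt T ^ 2 = T := Real.sq_sqrt hT0.le
  have hT1024 : (1024 : ℝ) ≤ T := by nlinarith
  have hTnat : 1024 ≤ T := by exact_mod_cast hT1024
  have hwT : 1 / (T : ℝ) ≤ w := by
    rw [hw, div_le_div_iff₀ hT0 hsqT]
    nlinarith
  have hprob := PartialObs.autocov_union hσ hindep hlaw hy hA hr0 hr1 hcontr (θ := 3 * w)
    (by positivity) (by linarith) (show 5 ≤ T by lia)
  have hfail : 12 * (no : ℝ) ^ 2 * Real.exp (-(((T : ℝ) - 5) * (3 * w) ^ 2 / 12)) ≤ δ := by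
    refine le_trans ?_ (htail hT1024)
    gcongr
  refine (show 1 - δ ≤ _ by linarith).trans (measureReal_mono (fun ω hω => ?_) (measure_ne_top _ _))
  -- The 8 is 2 · 3 from the two autocovariance deviations at θ = 3w, plus 2 from the bias.
  have hmom : ∀ m ≤ 3, ∀ i j, |PartialObs.momentEst T (fun t => y t ω) m i j - σ ^ 2 *
      (PartialObs.systemMatrix B C E ^ m) (Sum.inl i) (Sum.inl j)| ≤ σ ^ 2 * (8 * (c * w)) := by
    intro m hm i j
    obtain ⟨p, rfl⟩ : ∃ p, T = p + m + 2 := ⟨T - m - 2, by lia⟩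
    have h1 := hω ⟨m, by lia⟩ i j
    have h2 := hω ⟨m + 2, by lia⟩ i j
    have e1 : p + m + 2 - m = p + 2 := by lia
    have e2 : p + m + 2 - (m + 2) = p := by lia
    have e3 : ∀ k, 2 * k + (m + 2) = 2 * (k + 1) + m := fun k => by ring
    simp only [e1, e2, e3] at h1 h2
    push_cast at h1
    have h := PartialObs.abs_momentEst_sub_le (y := fun t => y t ω)
      (a := fun k => (PartialObs.systemMatrix B C E ^ (2 * k + m)) (Sum.inl i) (Sum.inl j))
      hr0 hr1 (fun k => (hcontr.abs_pow_apply_le hr0 _ _ _).trans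
        (pow_le_pow_of_le_one hr0 hr1.le (by lia))) hs.le (show 1 ≤ p by lia) i j h1 h2
    simp only [mul_zero, zero_add] at h
    refine h.trans (mul_le_mul_of_nonneg_left ?_ hs.le)
    have h3 : 1 / ((p : ℝ) + 2) ≤ 2 * w := by
      refine le_trans ?_ (mul_le_mul_of_nonneg_left hwT (zero_le_two (α := ℝ)))
      rw [mul_one_div, div_le_div_iff₀ (by positivity) hT0]
      have : p + m + 2 ≤ 2 * (p + 2) := by lia
      have : ((p + m + 2 : ℕ) : ℝ) ≤ 2 * ((p : ℝ) + 2) := by exact_mod_cast this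
      linarith
    have h4 : 1 / ((p : ℝ) + 2) * (1 / (1 - r)) ≤ 2 * w * c :=
      mul_le_mul h3 hc1 (by positivity) (by positivity)
    linarith
  obtain ⟨hvar, hBest, hrest⟩ := PartialObs.estimators_accurate hno hs (by positivity)
    (by linarith) (fun m i j => (hcontr.abs_pow_apply_le hr0 m i j).trans
      (pow_le_one₀ hr0 hr1.le)) hmom
  have hnoc : no * (4 * (8 * (c * w))) ≤ N * (32 * (c * w)) := by
    have := mul_le_mul_of_nonneg_right hnoN (by positivity : 0 ≤ 32 * (c * w))
    linarith
  refine ⟨fun h => ?_, fun h => ?_, fun h => ?_⟩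
  · obtain ⟨h1, h2⟩ := hmain 1 (by linarith)
    exact ⟨hvar.trans (by linarith), hBest.trans (by linarith)⟩
  · have hK : (20 * (N : ℝ)) ^ 2 * PartialObs.sampleSize σ ε δ r N ≤ T := by
      rw [mul_pow]
      exact (le_max_left _ _).trans h
    -- 20 N c w < 1/16 is precisely N · 32 c w < 1/10, the smallness needed by the perturbation
    -- bounds.
    have h1 := hsmall _ hK
    have h2 := (hmain _ hK).2
    refine (hrest (by linarith)).1.trans ?_
    have : 0 ≤ N * (32 * (c * w)) := by positivity
    linarith
  · have hK : (140 * (N : ℝ) ^ 2) ^ 2 * PartialObs.sampleSize σ ε δ r N ≤ T := by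
      rw [mul_pow, ← pow_mul]
      exact (le_max_left _ _).trans h
    have h1 := hsmall _ hK
    have h2 := (hmain _ hK).2
    have hN2 : (N : ℝ) ≤ (N : ℝ) ^ 2 := le_self_pow₀ hN1 two_ne_zero
    have h3 : N * (c * w) ≤ (N : ℝ) ^ 2 * (c * w) := by gcongr
    refine (hrest (by linarith)).2.trans ?_
    have h4 : (no : ℝ) ^ 2 * (32 * (c * w)) ≤ (N : ℝ) ^ 2 * (32 * (c * w)) := by gcongr
    have h5 : 0 ≤ (N : ℝ) ^ 2 * (32 * (c * w)) := by positivity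
    linarith
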